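/- Let $\mathbb{F}$ be any field and let $S$ be any set of $5\times 5$ matrices over $\mathbb{F}$. A word of length $k$ in $S$ is a product $a_1\cdots a_k$ with $a_1,\ldots,a_k\in S$, where the only word of length $0$ is the identity matrix. Let $\ell(S)$ be the smallest integer $k\geq 0$ for which the $\mathbb{F}$-linear span of all words in $S$ of length at most $k$ is the full (unital) $\mathbb{F}$-subalgebra of $\mathrm{Mat}_5(\mathbb{F})$ generated by $S$. Then $\ell(S)\leq 8$. -/

import Mathlib

/-- The set `S^k` of words of length `k` in `S`: all products `a₁ ⋯ aₖ` with every `aᵢ ∈ S`.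
The only word of length `0` is the empty product `1`. -/
def wordsOfLength {A : Type*} [Monoid A] (S : Set A) (k : ℕ) : Set A :=
  {a | ∃ w : List A, w.length = k ∧ (∀ x ∈ w, x ∈ S) ∧ w.prod = a}

/-- The `F`-linear span of all words in `S` of length at most `k`. -/
def spanWordsLE (F : Type*) {A : Type*} [Field F] [Ring A] [Algebra F A] (S : Set A) (k : ℕ) :
    Submodule F A :=
  Submodule.span F {a | ∃ i ≤ k, a ∈ wordsOfLength S i}

/-- The length `ℓ(S)`: the smallest `k` for which the words in `S` of length at most `k` span the
full (unital) subalgebra generated by `S`. It is `⊤` if there is no such `k`. -/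
noncomputable def algLength (F : Type*) {A : Type*} [Field F] [Ring A] [Algebra F A] (S : Set A) :
    ℕ∞ :=
  sInf ((fun k : ℕ => (k : ℕ∞)) ''
    {k : ℕ | spanWordsLE F S k = Subalgebra.toSubmodule (Algebra.adjoin F S)})

/-!
Let `L` be the span of `S` and the identity, so that the words of length at most `k` span `L ^ k`.
Extending scalars, the field may be taken algebraically closed. If `W` is invariant under `L` and
`x`, `z` agree with shorter `y`, `t` on `W` and on `V ⧸ W` respectively, then
`(x - y) * (z - t) = 0` shortens `x * z`; this reduces the bound to irreducible `L`.

Let `L` be irreducible, `dim V ≤ n + 1` and `L ^ (2 * n) ≠ End V`, and choose `X ≠ 0` orthogonal to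
`L ^ (2 * n)` for the trace form. Multiplying `X` by an element of `L ^ j` leaves it orthogonal to
`L ^ (2 * n - j)`, and a map of rank at most one orthogonal to `L ^ n` vanishes. Lowering the rank
of `X` this way without killing it is therefore impossible, which forces `X` to have rank at least
three. For `n ≤ 4` it also forces every element of `L` to satisfy a quadratic equation. Hence `L` is
closed under squares and so under the Jordan product, and then even a map of rank at most two
orthogonal to `L ^ (2 * n - 1)` vanishes. It follows that every `A` in `L` satisfies
`(A - c) * X = 0` for some scalar `c`, so `L` preserves every line in the range of `X`,
contradicting irreducibility.
-/

open Module Polynomial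

theorem pow_le_pow_of_pow_succ_le {M : Type*} [Monoid M] [Preorder M] [MulRightMono M] {a : M}
    {k m : ℕ} (h : a ^ (k + 1) ≤ a ^ k) (hkm : k ≤ m) : a ^ m ≤ a ^ k := by
  induction m, hkm using Nat.le_induction with
  | base => exact le_rfl
  | succ m _ ih =>
    calc a ^ (m + 1) = a ^ m * a := pow_succ a m
      _ ≤ a ^ k * a := mul_le_mul_left ih a
      _ = a ^ (k + 1) := (pow_succ a k).symm
      _ ≤ a ^ k := h

section Growth

variable {K A M : Type*} [Field K] [Ring A] [Algebra K A] [AddCommGroup M] [Module K M]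
  [Module A M] [IsScalarTower K A M] {L : Submodule K A}

theorem mem_smul_span_singleton_iff {x y : M} : y ∈ L • (K ∙ x) ↔ ∃ a ∈ L, a • x = y := by
  refine ⟨fun hy ↦ ?_, ?_⟩
  · refine Submodule.smul_induction_on hy (fun a ha z hz ↦ ?_) ?_
    · obtain ⟨c, rfl⟩ := Submodule.mem_span_singleton.mp hz
      exact ⟨c • a, L.smul_mem c ha, by rw [smul_assoc, smul_algebra_smul_comm]⟩
    · rintro _ _ ⟨a, ha, rfl⟩ ⟨b, hb, rfl⟩
      exact ⟨a + b, L.add_mem ha hb, add_smul a b x⟩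
  · rintro ⟨a, ha, rfl⟩
    exact Submodule.smul_mem_smul ha (Submodule.mem_span_singleton_self x)

theorem le_smul_of_one_le (h1 : 1 ≤ L) (I : Submodule K M) : I ≤ L • I := by
  simpa only [Submodule.one_smul] using Submodule.smul_mono_left (N := I) h1

theorem pow_succ_smul (I : Submodule K M) (k : ℕ) : L ^ (k + 1) • I = L • L ^ k • I := by
  rw [pow_succ']
  exact Submodule.smul_assoc L (L ^ k) I

theorem pow_succ_smul' (I : Submodule K M) (k : ℕ) : L ^ (k + 1) • I = L ^ k • L • I := by
  rw [pow_succ]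
  exact Submodule.smul_assoc (L ^ k) L I

theorem pow_smul_eq_of_pow_succ_smul_eq {I : Submodule K M} {k m : ℕ}
    (h : L ^ (k + 1) • I = L ^ k • I) (hkm : k ≤ m) : L ^ m • I = L ^ k • I := by
  induction m, hkm using Nat.le_induction with
  | base => rfl
  | succ m _ ih => rw [pow_succ_smul, ih, ← pow_succ_smul, h]

theorem pow_smul_le_pow_smul (h1 : 1 ≤ L) (I : Submodule K M) {k m : ℕ} (hkm : k ≤ m) :
    L ^ k • I ≤ L ^ m • I :=
  Submodule.smul_mono_left (pow_le_pow_right' h1 hkm)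

-- A chain that has not stabilized at step `k` has not stabilized earlier, so it grew `k` times.
theorem finrank_add_le_finrank_pow_smul [FiniteDimensional K M] (h1 : 1 ≤ L) {I : Submodule K M}
    {k : ℕ} (h : L ^ (k + 1) • I ≠ L ^ k • I) :
    finrank K I + k ≤ finrank K (L ^ k • I : Submodule K M) := by
  induction k with
  | zero => rw [pow_zero, Submodule.one_smul, add_zero]
  | succ k ih =>
    have hk : L ^ (k + 1) • I ≠ L ^ k • I := fun hk ↦ h <|
      (pow_smul_eq_of_pow_succ_smul_eq hk (by omega)).trans hk.symm
    have hlt := Submodule.finrank_lt_finrank_of_lt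
      ((pow_smul_le_pow_smul h1 I k.le_succ).lt_of_ne hk.symm)
    exact (Nat.succ_le_succ (ih hk)).trans hlt

theorem exists_span_pair_eq_smul_span_singleton [FiniteDimensional K M] (h1 : 1 ≤ L) {x : M}
    (hx : finrank K (L • (K ∙ x) : Submodule K M) ≤ 2) (hne : L • (K ∙ x) ≠ K ∙ x) :
    ∃ b ∈ L, Submodule.span K {x, b • x} = L • (K ∙ x) := by
  have hle := le_smul_of_one_le h1 (K ∙ x)
  obtain ⟨y, hy, hyx⟩ := SetLike.exists_of_lt (hle.lt_of_ne hne.symm)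
  obtain ⟨b, hb, rfl⟩ := mem_smul_span_singleton_iff.mp hy
  have hx0 : x ≠ 0 := by rintro rfl; simp at hyx
  have hlt : (K ∙ x) < Submodule.span K {x, b • x} :=
    SetLike.lt_iff_le_and_exists.mpr
      ⟨Submodule.span_mono (by simp), b • x, Submodule.subset_span (by simp), hyx⟩
  have hpair : Submodule.span K {x, b • x} ≤ L • (K ∙ x) :=
    Submodule.span_le.mpr (Set.pair_subset (hle (Submodule.mem_span_singleton_self x)) hy)
  have hfinrank := Submodule.finrank_lt_finrank_of_lt hlt
  rw [finrank_span_singleton hx0] at hfinrank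
  exact ⟨b, hb, Submodule.eq_of_le_of_finrank_le hpair (hx.trans hfinrank)⟩

theorem mul_add_mul_mem_of_mul_self_mem (hsq : ∀ a ∈ L, a * a ∈ L) {a b : A} (ha : a ∈ L)
    (hb : b ∈ L) : a * b + b * a ∈ L := by
  have : a * b + b * a = (a + b) * (a + b) - a * a - b * b := by noncomm_ring
  rw [this]
  exact L.sub_mem (L.sub_mem (hsq _ (L.add_mem ha hb)) (hsq a ha)) (hsq b hb)

theorem smul_smul_span_singleton_eq [FiniteDimensional K M] (h1 : 1 ≤ L)
    (hsq : ∀ a ∈ L, a * a ∈ L) {x : M} (hx : finrank K (L • (K ∙ x) : Submodule K M) ≤ 2) :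
    L • L • (K ∙ x) = L • (K ∙ x) := by
  by_cases hne : L • (K ∙ x) = K ∙ x
  · rw [hne, hne]
  obtain ⟨b, hb, hspan⟩ := exists_span_pair_eq_smul_span_singleton h1 hx hne
  have hmem {a : A} (ha : a ∈ L) : a • x ∈ L • (K ∙ x) :=
    mem_smul_span_singleton_iff.mpr ⟨a, ha, rfl⟩
  have hmul {a : A} (ha : a ∈ L) : a • b • x ∈ L • (K ∙ x) := by
    obtain ⟨s, t, hst⟩ := Submodule.mem_span_pair.mp (hspan ▸ hmem ha)
    -- `c` annihilates `x`, so the product `c * b` acts on `x` as the Jordan product of `c` and `b`.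
    let c := a - s • 1 - t • b
    have hc : c ∈ L :=
      L.sub_mem (L.sub_mem ha (L.smul_mem s (Submodule.one_le.mp h1))) (L.smul_mem t hb)
    have hcx : c • x = 0 := by
      simp only [c, sub_smul, smul_assoc, one_smul, ← hst]
      abel
    have hab : a • b • x = (c * b + b * c) • x + s • b • x + t • (b * b) • x := by
      rw [add_smul, mul_smul b c, hcx, smul_zero]
      simp only [c, sub_mul, sub_smul, smul_mul_assoc, one_mul, smul_assoc, mul_smul]
      abel
    rw [hab]
    exact add_mem (add_mem (hmem (mul_add_mul_mem_of_mul_self_mem hsq hc hb))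
      (Submodule.smul_mem _ s (hmem hb))) (Submodule.smul_mem _ t (hmem (hsq b hb)))
  refine le_antisymm (Submodule.smul_le.mpr fun a ha y hy ↦ ?_) (le_smul_of_one_le h1 _)
  rw [← hspan] at hy
  obtain ⟨s, t, rfl⟩ := Submodule.mem_span_pair.mp hy
  rw [smul_add, smul_algebra_smul_comm, smul_algebra_smul_comm]
  exact add_mem (Submodule.smul_mem _ s (hmem ha)) (Submodule.smul_mem _ t (hmul ha))

theorem pow_succ_smul_span_singleton_eq [FiniteDimensional K M] (h1 : 1 ≤ L)
    (hsq : ∀ a ∈ L, a * a ∈ L) {x : M} (hx : finrank K (L • (K ∙ x) : Submodule K M) ≤ 2) (k : ℕ) :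
    L ^ (k + 1) • (K ∙ x) = L • (K ∙ x) := by
  induction k with
  | zero => rw [zero_add, pow_one]
  | succ k ih => rw [pow_succ_smul, ih, smul_smul_span_singleton_eq h1 hsq hx]

end Growth

section Irreducible

variable {K V : Type*} [Field K] [AddCommGroup V] [Module K V] {L : Submodule K (End K V)}

/-- `L` leaves no subspace invariant other than `⊥` and `⊤`. The zero space is allowed. -/
def ActsIrreducibly (L : Submodule K (End K V)) : Prop :=
  ∀ W : Submodule K V, L • W ≤ W → W = ⊥ ∨ W = ⊤

variable [FiniteDimensional K V]

theorem ActsIrreducibly.pow_smul_eq_top (hL : ActsIrreducibly L) (h1 : 1 ≤ L)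
    {I : Submodule K V} (hI : I ≠ ⊥) {k : ℕ} (hk : finrank K V ≤ finrank K I + k) :
    L ^ k • I = ⊤ := by
  by_cases h : L ^ (k + 1) • I = L ^ k • I
  · refine (hL _ ?_).resolve_left fun hbot ↦ hI (le_bot_iff.mp ?_)
    · rw [← pow_succ_smul, h]
    · exact hbot ▸ le_smul_of_one_le (one_le_pow_of_one_le' h1 k) I
  · exact Submodule.eq_top_of_finrank_eq (le_antisymm (Submodule.finrank_le _)
      (hk.trans (finrank_add_le_finrank_pow_smul h1 h)))

theorem ActsIrreducibly.exists_mem_pow_apply_eq (hL : ActsIrreducibly L) (h1 : 1 ≤ L) {u : V}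
    (hu : u ≠ 0) {n : ℕ} (hn : finrank K V ≤ n + 1) (v : V) : ∃ a ∈ L ^ n, a u = v := by
  have htop : L ^ n • (K ∙ u) = ⊤ := hL.pow_smul_eq_top h1
    (by rwa [Ne, Submodule.span_singleton_eq_bot]) (by rw [finrank_span_singleton hu]; omega)
  exact mem_smul_span_singleton_iff.mp (htop ▸ Submodule.mem_top : v ∈ L ^ n • (K ∙ u))

theorem ActsIrreducibly.finrank_le_finrank_pow_smul (hL : ActsIrreducibly L) (h1 : 1 ≤ L)
    {Y : End K V} (hY : Y ≠ 0) {n : ℕ} (hn : finrank K V ≤ n + 1) :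
    finrank K V ≤ finrank K (L ^ n • (K ∙ Y) : Submodule K (End K V)) := by
  obtain ⟨v, hv⟩ := DFunLike.ne_iff.mp hY
  let ev : (L ^ n • (K ∙ Y) : Submodule K (End K V)) →ₗ[K] V :=
    (LinearMap.applyₗ v).domRestrict _
  refine LinearMap.finrank_le_finrank_of_surjective (f := ev) fun w ↦ ?_
  obtain ⟨a, ha, rfl⟩ := hL.exists_mem_pow_apply_eq h1 hv hn w
  exact ⟨⟨a * Y, mem_smul_span_singleton_iff.mpr ⟨a, ha, rfl⟩⟩, rfl⟩

end Irreducible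

section TraceForm

variable {K V : Type*} [Field K] [AddCommGroup V] [Module K V]

/-- `X` is orthogonal to the space `W` with respect to the trace form `(X, Y) ↦ tr (X Y)`. -/
def TraceOrthogonal (W : Submodule K (End K V)) (X : End K V) : Prop :=
  ∀ w ∈ W, LinearMap.trace K V (X * w) = 0

theorem TraceOrthogonal.mul_left {L : Submodule K (End K V)} (h1 : 1 ≤ L) {X a : End K V}
    {i j k : ℕ} (hX : TraceOrthogonal (L ^ k) X) (ha : a ∈ L ^ j) (hk : i + j ≤ k) :
    TraceOrthogonal (L ^ i) (a * X) := by
  intro w hw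
  have hwa : w * a ∈ L ^ k :=
    pow_le_pow_right' h1 hk (pow_add L i j ▸ Submodule.mul_mem_mul hw ha)
  rw [mul_assoc, LinearMap.trace_mul_comm, mul_assoc]
  exact hX _ hwa

theorem exists_smulRight_eq_of_range_le {Y : End K V} {u : V} (hu : u ≠ 0)
    (hY : LinearMap.range Y ≤ K ∙ u) : ∃ f : Dual K V, Y = f.smulRight u := by
  have hYu (v : V) : Y v ∈ K ∙ u := hY ⟨v, rfl⟩
  refine ⟨LinearEquiv.coord K V u hu ∘ₗ Y.codRestrict _ hYu, LinearMap.ext fun v ↦ ?_⟩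
  exact (LinearEquiv.coord_apply_smul K V u hu ⟨Y v, hYu v⟩).symm

variable [FiniteDimensional K V]

theorem trace_mul_smulRight (X : End K V) (f : Dual K V) (v : V) :
    LinearMap.trace K V (X * f.smulRight v) = f (X v) := by
  have : X * f.smulRight v = f.smulRight (X v) := by ext; simp
  rw [this, LinearMap.trace_smulRight]

theorem exists_forall_trace_mul_eq (φ : Dual K (End K V)) :
    ∃ X : End K V, ∀ Y, LinearMap.trace K V (X * Y) = φ Y := by
  let T : End K V →ₗ[K] Dual K (End K V) :=
    (LinearMap.mul K (End K V)).compr₂ (LinearMap.trace K V)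
  have hT : Function.Injective T := by
    refine (injective_iff_map_eq_zero T).mpr fun X hX ↦ LinearMap.ext fun v ↦ ?_
    refine (forall_dual_apply_eq_zero_iff K (X v)).mp fun f ↦ ?_
    rw [← trace_mul_smulRight]
    exact LinearMap.congr_fun hX (f.smulRight v)
  obtain ⟨X, rfl⟩ := (LinearMap.injective_iff_surjective_of_finrank_eq_finrank
    Subspace.dual_finrank_eq.symm).mp hT φ
  exact ⟨X, fun _ ↦ rfl⟩

theorem exists_traceOrthogonal_ne_zero {W : Submodule K (End K V)} (hW : W ≠ ⊤) :
    ∃ X, X ≠ 0 ∧ TraceOrthogonal W X := by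
  obtain ⟨φ, hφ, hker⟩ := Submodule.exists_le_ker_of_lt_top W hW.lt_top
  obtain ⟨X, hX⟩ := exists_forall_trace_mul_eq φ
  refine ⟨X, ?_, fun w hw ↦ (hX w).trans (hker hw)⟩
  rintro rfl
  exact hφ (LinearMap.ext fun Y ↦ by rw [← hX Y, zero_mul, map_zero, LinearMap.zero_apply])

theorem ActsIrreducibly.eq_zero_of_finrank_range_le_one {L : Submodule K (End K V)}
    (hL : ActsIrreducibly L) (h1 : 1 ≤ L) {n : ℕ} (hn : finrank K V ≤ n + 1) {Y : End K V}
    (hY : TraceOrthogonal (L ^ n) Y) (hrank : finrank K (LinearMap.range Y) ≤ 1) : Y = 0 := by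
  by_contra hY0
  obtain ⟨v, hv⟩ := DFunLike.ne_iff.mp hY0
  have hrange : LinearMap.range Y ≤ K ∙ Y v := by
    refine (Submodule.eq_of_le_of_finrank_le (Submodule.span_le.mpr ?_) ?_).ge
    · exact Set.singleton_subset_iff.mpr ⟨v, rfl⟩
    · rwa [finrank_span_singleton hv]
  obtain ⟨f, hf⟩ := exists_smulRight_eq_of_range_le hv hrange
  have hf0 : f = 0 := by
    ext w
    obtain ⟨a, ha, rfl⟩ := hL.exists_mem_pow_apply_eq h1 hv hn w
    rw [LinearMap.zero_apply, ← trace_mul_smulRight, ← hf, LinearMap.trace_mul_comm]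
    exact hY a ha
  exact hY0 (by rw [hf, hf0, LinearMap.zero_smulRight])

end TraceForm

section InvariantSubspace

variable {K V : Type*} [Field K] [AddCommGroup V] [Module K V]

/-- The algebra of endomorphisms leaving the subspace `W` invariant. It is the source of the
restriction to `W` and of the action on `V ⧸ W` as algebra homomorphisms. -/
def invariantSubalgebra (W : Submodule K V) : Subalgebra K (End K V) where
  carrier := {a | ∀ w ∈ W, a w ∈ W}
  mul_mem' ha hb w hw := ha _ (hb w hw)
  add_mem' ha hb w hw := W.add_mem (ha w hw) (hb w hw)
  algebraMap_mem' c _ hw := W.smul_mem c hw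

/-- The restriction of endomorphisms to an invariant subspace. -/
def restrictHom (W : Submodule K V) : invariantSubalgebra W →ₐ[K] End K W where
  toFun a := a.1.restrict a.2
  map_one' := rfl
  map_mul' _ _ := rfl
  map_zero' := rfl
  map_add' _ _ := rfl
  commutes' _ := rfl

/-- The action of endomorphisms on the quotient by an invariant subspace. -/
def quotientHom (W : Submodule K V) : invariantSubalgebra W →ₐ[K] End K (V ⧸ W) where
  toFun a := W.mapQ W a.1 a.2
  map_one' := W.mapQ_id
  map_mul' a b := W.mapQ_comp W W b.1 a.1 b.2 a.2
  map_zero' := W.mapQ_zero W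
  map_add' _ _ := Submodule.linearMap_qext _ rfl
  commutes' _ := Submodule.linearMap_qext _ rfl

theorem mul_eq_zero_of_restrictHom_of_quotientHom {W : Submodule K V} {a b : invariantSubalgebra W}
    (ha : restrictHom W a = 0) (hb : quotientHom W b = 0) : a * b = 0 := by
  ext v
  have hv : b.1 v ∈ W := (Submodule.Quotient.mk_eq_zero W).mp (LinearMap.congr_fun hb (W.mkQ v))
  exact congrArg Subtype.val (LinearMap.congr_fun ha ⟨b.1 v, hv⟩)

theorem aeval_mem_invariantSubalgebra {W : Submodule K V} {A : End K V}
    (hA : A ∈ invariantSubalgebra W) (p : K[X]) : aeval A p ∈ invariantSubalgebra W :=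
  aeval_algHom_apply (invariantSubalgebra W).val ⟨A, hA⟩ p ▸ SetLike.coe_mem _

theorem aeval_charpoly_restrict_apply [FiniteDimensional K V] {W : Submodule K V} {A : End K V}
    (hA : A ∈ invariantSubalgebra W) {w : V} (hw : w ∈ W) :
    aeval A (A.restrict hA).charpoly w = 0 := by
  have h : restrictHom W (aeval ⟨A, hA⟩ (A.restrict hA).charpoly) = 0 := by
    rw [← aeval_algHom_apply]
    exact (A.restrict hA).aeval_self_charpoly
  refine (LinearMap.congr_fun (aeval_algHom_apply (invariantSubalgebra W).val ⟨A, hA⟩ _) w).trans ?_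
  exact congrArg Subtype.val (LinearMap.congr_fun h ⟨w, hw⟩)

end InvariantSubspace

section Rank

variable {K V : Type*} [Field K] [AddCommGroup V] [Module K V] [FiniteDimensional K V]

theorem finrank_range_mul_le_left (a b : End K V) :
    finrank K (LinearMap.range (a * b)) ≤ finrank K (LinearMap.range a) :=
  Submodule.finrank_mono (LinearMap.range_comp_le_range b a)

theorem finrank_map_add_finrank_ker_inf (a : End K V) (G : Submodule K V) :
    finrank K (G.map a) + finrank K (LinearMap.ker a ⊓ G : Submodule K V) = finrank K G := by
  rw [← LinearMap.range_domRestrict, inf_comm, ← Submodule.map_comap_subtype,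
    Submodule.finrank_map_subtype_eq, ← LinearMap.ker_comp]
  exact LinearMap.finrank_range_add_finrank_ker (a.domRestrict G)

theorem finrank_map_lt {a : End K V} {G : Submodule K V} {v : V} (hv : v ∈ G) (hv0 : v ≠ 0)
    (hav : a v = 0) : finrank K (G.map a) < finrank K G := by
  have hker : LinearMap.ker a ⊓ G ≠ ⊥ := Submodule.ne_bot_iff _ |>.mpr ⟨v, ⟨hav, hv⟩, hv0⟩
  have := finrank_map_add_finrank_ker_inf a G
  have := Submodule.one_le_finrank_iff.mpr hker
  omega

theorem finrank_range_add_finrank_range_le {a b : End K V} (hab : a * b = 0) :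
    finrank K (LinearMap.range a) + finrank K (LinearMap.range b) ≤ finrank K V := by
  rw [← LinearMap.finrank_range_add_finrank_ker a]
  exact Nat.add_le_add_left (Submodule.finrank_mono (LinearMap.range_le_ker_iff.mpr hab)) _

end Rank

section AlgClosed

variable {K V : Type*} [Field K] [AddCommGroup V] [Module K V]

theorem aeval_mem_pow {A : Type*} [Ring A] [Algebra K A] {L : Submodule K A} (h1 : 1 ≤ L) {a : A}
    (ha : a ∈ L) (p : K[X]) : aeval a p ∈ L ^ p.natDegree := by
  rw [aeval_eq_sum_range]
  refine sum_mem fun i hi ↦ Submodule.smul_mem _ _ ?_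
  exact pow_le_pow_right' h1 (by grind) (Submodule.pow_mem_pow L ha i)

variable [IsAlgClosed K]

theorem exists_aeval_smul_eigenvector {A M : Type*} [Ring A] [Algebra K A] [AddCommGroup M]
    [Module K M] [Module A M] [IsScalarTower K A M] {a : A} {x : M} (hx : x ≠ 0) {p : K[X]}
    (hp0 : p ≠ 0) (hp : aeval a p • x = 0) :
    ∃ (μ : K) (q : K[X]), q.natDegree < p.natDegree ∧ aeval a q • x ≠ 0 ∧
      a • aeval a q • x = μ • aeval a q • x := by
  induction hd : p.natDegree generalizing p with
  | zero =>
    obtain ⟨c, rfl⟩ := natDegree_eq_zero.mp hd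
    rw [aeval_C, algebraMap_smul] at hp
    exact absurd hp (smul_ne_zero (C_ne_zero.mp hp0) hx)
  | succ d ih =>
    obtain ⟨μ, hμ⟩ := IsAlgClosed.exists_root p (degree_ne_of_natDegree_ne (hd ▸ d.succ_ne_zero))
    obtain ⟨q, rfl⟩ := dvd_iff_isRoot.mpr hμ
    have hq0 : q ≠ 0 := right_ne_zero_of_mul hp0
    have hqd : q.natDegree = d := by
      rw [natDegree_mul (X_sub_C_ne_zero μ) hq0, natDegree_X_sub_C] at hd
      omega
    by_cases hq : aeval a q • x = 0
    · obtain ⟨ν, r, hr, h⟩ := ih hq0 hq hqd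
      exact ⟨ν, r, hr.trans d.lt_succ_self, h⟩
    · refine ⟨μ, q, hqd ▸ d.lt_succ_self, hq, sub_eq_zero.mp ?_⟩
      rw [← hp, map_mul, mul_smul, map_sub, aeval_X, aeval_C, sub_smul, algebraMap_smul]

theorem exists_singular_pencil {Z : Type*} [AddCommGroup Z] [Module K Z] [FiniteDimensional K Z]
    [FiniteDimensional K V] [Nontrivial Z] (hZ : finrank K V ≤ finrank K Z) (f g : Z →ₗ[K] V) :
    ∃ a b : K, (a ≠ 0 ∨ b ≠ 0) ∧ ∃ z : Z, z ≠ 0 ∧ a • f z + b • g z = 0 := by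
  by_cases hf : Function.Injective f
  · let e := LinearEquiv.ofInjectiveOfFinrankEq f hf
      (le_antisymm (LinearMap.finrank_le_finrank_of_injective hf) hZ)
    obtain ⟨μ, hμ⟩ := End.exists_eigenvalue (e.symm.toLinearMap ∘ₗ g)
    obtain ⟨z, hz⟩ := hμ.exists_hasEigenvector
    have hgz : g z = μ • f z := e.symm.injective <| hz.apply_eq_smul.trans <| by
      rw [map_smul]
      exact congrArg _ (e.symm_apply_apply z).symm
    exact ⟨-μ, 1, .inr one_ne_zero, z, hz.2, by rw [hgz]; module⟩
  · obtain ⟨z, hz, hz0⟩ : ∃ z, f z = 0 ∧ z ≠ 0 := by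
      simpa [injective_iff_map_eq_zero] using hf
    exact ⟨1, 0, .inl one_ne_zero, z, hz0, by rw [hz]; module⟩

variable [FiniteDimensional K V]

theorem exists_mem_finrank_range_mul_lt {W : Submodule K (End K V)} {Y : End K V}
    (hY : 1 < finrank K (LinearMap.range Y))
    (hW : finrank K V ≤ finrank K (W • (K ∙ Y) : Submodule K (End K V))) :
    ∃ a ∈ W, a * Y ≠ 0 ∧ finrank K (LinearMap.range (a * Y)) < finrank K (LinearMap.range Y) := by
  have hV : 1 < finrank K V := hY.trans_le (Submodule.finrank_le _)
  have : Nontrivial (W • (K ∙ Y) : Submodule K (End K V)) :=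
    nontrivial_of_finrank_pos (by omega : 0 < finrank K (W • (K ∙ Y) : Submodule K (End K V)))
  have : Nontrivial (LinearMap.range Y) := nontrivial_of_finrank_pos (zero_lt_one.trans hY)
  obtain ⟨⟨_, v, rfl⟩, hv⟩ := exists_ne (0 : LinearMap.range Y)
  obtain ⟨⟨_, w, rfl⟩, hvw⟩ := exists_linearIndependent_pair_of_one_lt_finrank hY hv
  let ev (u : V) : (W • (K ∙ Y) : Submodule K (End K V)) →ₗ[K] V :=
    (LinearMap.applyₗ u).domRestrict _
  obtain ⟨s, t, hst, ⟨_, hz⟩, hz0, h⟩ := exists_singular_pencil hW (ev v) (ev w)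
  obtain ⟨a, ha, rfl⟩ := mem_smul_span_singleton_iff.mp hz
  have hne : s • Y v + t • Y w ≠ 0 := by
    intro h0
    obtain ⟨rfl, rfl⟩ := LinearIndependent.pair_iff.mp hvw s t (Subtype.ext h0)
    simp at hst
  have hmem : s • Y v + t • Y w ∈ LinearMap.range Y := ⟨s • v + t • w, by simp⟩
  refine ⟨a, ha, fun h ↦ hz0 (Subtype.ext h), ?_⟩
  rw [End.mul_eq_comp, LinearMap.range_comp]
  exact finrank_map_lt hmem hne (by rw [map_add, map_smul, map_smul]; exact h)

end AlgClosed

section Trace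

variable {K V : Type*} [Field K] [IsAlgClosed K] [AddCommGroup V] [Module K V]
  [FiniteDimensional K V] {L : Submodule K (End K V)}

theorem ActsIrreducibly.finrank_pow_smul_lt (hL : ActsIrreducibly L) (h1 : 1 ≤ L) {n j k : ℕ}
    (hn : finrank K V ≤ n + 1) (hk : n + j ≤ k) {Y : End K V} (hY0 : Y ≠ 0)
    (hY : TraceOrthogonal (L ^ k) Y) (hrank : finrank K (LinearMap.range Y) ≤ 2) :
    finrank K (L ^ j • (K ∙ Y) : Submodule K (End K V)) < finrank K V := by
  by_contra! hle
  have hrank1 : 1 < finrank K (LinearMap.range Y) := by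
    by_contra! h
    exact hY0 (hL.eq_zero_of_finrank_range_le_one h1 hn
      (fun w hw ↦ hY w (pow_le_pow_right' h1 (by omega) hw)) h)
  obtain ⟨a, ha, haY, hlt⟩ := exists_mem_finrank_range_mul_lt hrank1 hle
  exact haY (hL.eq_zero_of_finrank_range_le_one h1 hn (hY.mul_left h1 ha hk) (by omega))

theorem ActsIrreducibly.exists_two_le_finrank_eigenspace_inf (hL : ActsIrreducibly L) (h1 : 1 ≤ L)
    {n k : ℕ} (hn : finrank K V ≤ n + 1) {A : End K V} (hA : A ∈ L) {G : Submodule K V}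
    (hG : A ∈ invariantSubalgebra G) (hk : finrank K G + n ≤ k + 1) {Z : End K V} (hZ0 : Z ≠ 0)
    (hZ : TraceOrthogonal (L ^ k) Z) (hZG : LinearMap.range Z ≤ G) :
    ∃ μ, 2 ≤ finrank K (A.eigenspace μ ⊓ G : Submodule K V) := by
  have hp : aeval A (A.restrict hG).charpoly • Z = 0 :=
    LinearMap.ext fun v ↦ aeval_charpoly_restrict_apply hG (hZG ⟨v, rfl⟩)
  obtain ⟨μ, q, hq, hqZ, hμ⟩ :=
    exists_aeval_smul_eigenvector hZ0 (A.restrict hG).charpoly_monic.ne_zero hp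
  rw [LinearMap.charpoly_natDegree] at hq
  refine ⟨μ, not_lt.mp fun hlt ↦ hqZ ?_⟩
  have hrange : LinearMap.range (aeval A q * Z) ≤ A.eigenspace μ ⊓ G := by
    rintro _ ⟨v, rfl⟩
    exact ⟨End.mem_eigenspace_iff.mpr (LinearMap.congr_fun hμ v),
      aeval_mem_invariantSubalgebra hG q _ (hZG ⟨v, rfl⟩)⟩
  have hortho : TraceOrthogonal (L ^ n) (aeval A q * Z) :=
    hZ.mul_left h1 (aeval_mem_pow h1 hA q) (by omega)
  exact hL.eq_zero_of_finrank_range_le_one h1 hn hortho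
    ((Submodule.finrank_mono hrange).trans (Nat.le_of_lt_succ hlt))

theorem exists_finrank_map_sub_smul_lt {A : End K V} {G : Submodule K V}
    (hA : A ∈ invariantSubalgebra G) (hG : G ≠ ⊥) :
    ∃ μ : K, finrank K (G.map (A - μ • 1)) < finrank K G := by
  have : Nontrivial G := Submodule.nontrivial_iff_ne_bot.mpr hG
  obtain ⟨μ, hμ⟩ := End.exists_eigenvalue (A.restrict hA)
  obtain ⟨v, hv⟩ := hμ.exists_hasEigenvector
  have hAv : A v = μ • (v : V) := congrArg Subtype.val hv.apply_eq_smul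
  exact ⟨μ, finrank_map_lt v.2 (by simpa using hv.2) (by simp [hAv])⟩

end Trace

section Obstruction

variable {K V : Type*} [Field K] [AddCommGroup V] [Module K V] {L : Submodule K (End K V)}
  {n : ℕ} {X : End K V}

/-- A witness `X` that the words of length at most `2 * n` in an irreducible space `L` of letters
do not span `End K V`, where `dim V ≤ n + 1`. Including `1` in `L` makes `L ^ k` the span of the
words of length at most `k`. The purpose of the notion is to be refuted for `n ≤ 4`. -/
structure IsPazObstruction (n : ℕ) (L : Submodule K (End K V)) (X : End K V) : Prop where
  finrank_le : finrank K V ≤ n + 1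
  one_le : 1 ≤ L
  irreducible : ActsIrreducibly L
  ne_zero : X ≠ 0
  orthogonal : TraceOrthogonal (L ^ (2 * n)) X

namespace IsPazObstruction

theorem mul_left (h : IsPazObstruction n L X) {a : End K V} {i j : ℕ} (ha : a ∈ L ^ j)
    (hij : i + j ≤ 2 * n) : TraceOrthogonal (L ^ i) (a * X) :=
  h.orthogonal.mul_left h.one_le ha hij

theorem sub_smul_one_mem (h : IsPazObstruction n L X) {A : End K V} (hA : A ∈ L) (μ : K) :
    A - μ • 1 ∈ L :=
  L.sub_mem hA (L.smul_mem μ (Submodule.one_le.mp h.one_le))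

variable [IsAlgClosed K] [FiniteDimensional K V]

theorem two_lt_finrank_range (h : IsPazObstruction n L X) :
    2 < finrank K (LinearMap.range X) := by
  by_contra! hX
  exact (h.irreducible.finrank_pow_smul_lt h.one_le h.finrank_le (two_mul n).ge h.ne_zero
    h.orthogonal hX).not_ge
      (h.irreducible.finrank_le_finrank_pow_smul h.one_le h.ne_zero h.finrank_le)

theorem two_lt_finrank (h : IsPazObstruction n L X) : 2 < finrank K V :=
  h.two_lt_finrank_range.trans_le (Submodule.finrank_le _)

theorem eq_zero_of_mem_sq (h : IsPazObstruction n L X) {R : End K V} (hR : R ∈ L ^ 2)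
    (hrank : finrank K (LinearMap.range R) ≤ 1) : R = 0 := by
  have hX := h.two_lt_finrank_range
  have hn := h.finrank_le
  have hV := h.two_lt_finrank
  obtain ⟨m, rfl⟩ : ∃ m, n = 2 + m := ⟨n - 2, by omega⟩
  have htop : L ^ m • LinearMap.range X = ⊤ :=
    h.irreducible.pow_smul_eq_top h.one_le (mt LinearMap.range_eq_bot.mp h.ne_zero) (by omega)
  rw [← LinearMap.ker_eq_top, eq_top_iff, ← htop, Submodule.smul_le]
  rintro a ha _ ⟨v, rfl⟩
  have hRa : R * a ∈ L ^ (2 + m) := pow_add L 2 m ▸ Submodule.mul_mem_mul hR ha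
  have hrank' : finrank K (LinearMap.range (R * a * X)) ≤ 1 :=
    (finrank_range_mul_le_left _ X).trans ((finrank_range_mul_le_left R a).trans hrank)
  exact LinearMap.congr_fun (h.irreducible.eq_zero_of_finrank_range_le_one h.one_le hn
    (h.mul_left hRa (two_mul _).ge) hrank') v

-- `A` has an eigenspace of dimension at least two. On the range of the corresponding `A - c`, some
-- `A - d` loses enough rank for the product to have rank at most one.
theorem exists_quadratic (h : IsPazObstruction n L X) (hn : n ≤ 4) {A : End K V} (hA : A ∈ L) :
    ∃ c d : K, (A - d • 1) * (A - c • 1) = 0 := by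
  have hV := h.finrank_le
  have hX := h.two_lt_finrank_range
  obtain ⟨c, hc⟩ := h.irreducible.exists_two_le_finrank_eigenspace_inf h.one_le hV hA
    (G := ⊤) (fun _ _ ↦ trivial) (by rw [finrank_top]; omega) h.ne_zero h.orthogonal le_top
  set N := A - c • 1 with hN
  have hrank := LinearMap.finrank_range_add_finrank_ker N
  rw [inf_top_eq, End.eigenspace_def, ← hN] at hc
  have hNL : N ∈ L := h.sub_smul_one_mem hA c
  have hcomm : A * N = N * A := by rw [hN]; noncomm_ring
  have hG : A ∈ invariantSubalgebra (LinearMap.range N) := by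
    rintro _ ⟨v, rfl⟩
    exact ⟨A v, (LinearMap.congr_fun hcomm v).symm⟩
  suffices ∃ d : K, finrank K ((LinearMap.range N).map (A - d • 1)) ≤ 1 by
    obtain ⟨d, hd⟩ := this
    refine ⟨c, d, h.eq_zero_of_mem_sq ?_ (by rwa [End.mul_eq_comp, LinearMap.range_comp])⟩
    exact pow_two L ▸ Submodule.mul_mem_mul (h.sub_smul_one_mem hA d) hNL
  by_cases hNX : N * X = 0
  · have hrankN := finrank_range_add_finrank_range_le hNX
    by_cases hbot : LinearMap.range N = ⊥
    · exact ⟨0, by rw [hbot, Submodule.map_bot, finrank_bot]; exact zero_le_one⟩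
    · obtain ⟨d, hd⟩ := exists_finrank_map_sub_smul_lt hG hbot
      exact ⟨d, by omega⟩
  · have hortho : TraceOrthogonal (L ^ (2 * n - 1)) (N * X) :=
      h.mul_left (j := 1) (by rwa [pow_one]) (by omega)
    obtain ⟨d, hd⟩ := h.irreducible.exists_two_le_finrank_eigenspace_inf h.one_le hV hA hG
      (by omega) hNX hortho (LinearMap.range_comp_le_range X N)
    have := finrank_map_add_finrank_ker_inf (A - d • 1) (LinearMap.range N)
    rw [End.eigenspace_def] at hd
    exact ⟨d, by omega⟩

theorem mul_self_mem (h : IsPazObstruction n L X) (hn : n ≤ 4) {A : End K V} (hA : A ∈ L) :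
    A * A ∈ L := by
  obtain ⟨c, d, hcd⟩ := h.exists_quadratic hn hA
  have : A * A = (c + d) • A - (d * c) • 1 := by
    simp only [sub_mul, mul_sub, smul_mul_assoc, mul_smul_comm, one_mul, mul_one] at hcd
    rw [← sub_eq_zero, ← hcd]
    module
  rw [this]
  exact L.sub_mem (L.smul_mem _ hA) (L.smul_mem _ (Submodule.one_le.mp h.one_le))

-- The chain `L ^ j • (K ∙ Y)` cannot have stabilized by step `n`, and it is too small at step
-- `n - 1`: so it has dimension at most two at step one, where closure under squares stops it.
theorem eq_zero_of_finrank_range_le_two (h : IsPazObstruction n L X) (hn : n ≤ 4) {Y : End K V}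
    {k : ℕ} (hk : 2 * n ≤ k + 1) (hY : TraceOrthogonal (L ^ k) Y)
    (hrank : finrank K (LinearMap.range Y) ≤ 2) : Y = 0 := by
  by_contra hY0
  have hV := h.finrank_le
  have hV2 := h.two_lt_finrank
  obtain ⟨m, rfl⟩ : ∃ m, n = m + 2 := ⟨n - 2, by omega⟩
  have hlarge := h.irreducible.finrank_le_finrank_pow_smul h.one_le hY0 hV
  have hsmall := h.irreducible.finrank_pow_smul_lt h.one_le hV (j := m + 1) (by omega) hY0 hY hrank
  have hne : L ^ (m + 2) • (K ∙ Y) ≠ L ^ (m + 1) • (K ∙ Y) :=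
    fun heq ↦ (heq ▸ hsmall).not_ge hlarge
  have hgrow : finrank K (L • (K ∙ Y) : Submodule K (End K V)) + m ≤
      finrank K (L ^ (m + 1) • (K ∙ Y) : Submodule K (End K V)) := by
    rw [pow_succ_smul' _ (m + 1), pow_succ_smul' (K ∙ Y) m] at hne
    rw [pow_succ_smul']
    exact finrank_add_le_finrank_pow_smul h.one_le hne
  have hpow := pow_succ_smul_span_singleton_eq h.one_le (fun _ ↦ h.mul_self_mem hn) (x := Y)
    (by omega)
  exact hne ((hpow (m + 1)).trans (hpow m).symm)

theorem exists_sub_smul_mul_eq_zero (h : IsPazObstruction n L X) (hn : n ≤ 4) {A : End K V}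
    (hA : A ∈ L) : ∃ c : K, (A - c • 1) * X = 0 := by
  have hV := h.finrank_le
  obtain ⟨c, d, hcd⟩ := h.exists_quadratic hn hA
  have hsum := finrank_range_add_finrank_range_le hcd
  have key (μ : K) (hμ : finrank K (LinearMap.range (A - μ • 1)) ≤ 2) : (A - μ • 1) * X = 0 :=
    h.eq_zero_of_finrank_range_le_two hn (k := 2 * n - 1) (by omega)
      (h.mul_left (j := 1) (by rw [pow_one]; exact h.sub_smul_one_mem hA μ)
        (by have := h.two_lt_finrank; omega))
      ((finrank_range_mul_le_left _ X).trans hμ)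
  obtain hc | hd : finrank K (LinearMap.range (A - c • 1)) ≤ 2 ∨
      finrank K (LinearMap.range (A - d • 1)) ≤ 2 := by omega
  · exact ⟨c, key c hc⟩
  · exact ⟨d, key d hd⟩

theorem four_lt (h : IsPazObstruction n L X) : 4 < n := by
  by_contra! hn
  have hV := h.two_lt_finrank
  obtain ⟨v, hv⟩ := DFunLike.ne_iff.mp h.ne_zero
  have hinv : L • (K ∙ X v) ≤ K ∙ X v := by
    intro w hw
    obtain ⟨A, hA, rfl⟩ := mem_smul_span_singleton_iff.mp hw
    obtain ⟨c, hc⟩ := h.exists_sub_smul_mul_eq_zero hn hA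
    have hAX : A (X v) = c • X v := sub_eq_zero.mp (LinearMap.congr_fun hc v)
    exact Submodule.mem_span_singleton.mpr ⟨c, hAX.symm⟩
  have hfinrank := finrank_span_singleton (K := K) hv
  rcases h.irreducible _ hinv with hbot | htop
  · exact hv (Submodule.span_singleton_eq_bot.mp hbot)
  · rw [htop, finrank_top] at hfinrank
    omega

end IsPazObstruction

theorem ActsIrreducibly.pow_eq_top [IsAlgClosed K] [FiniteDimensional K V] (hL : ActsIrreducibly L)
    (h1 : 1 ≤ L) (hV : finrank K V ≤ n + 1) (hn : n ≤ 4) : L ^ (2 * n) = ⊤ := by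
  by_contra hne
  obtain ⟨X, hX0, hX⟩ := exists_traceOrthogonal_ne_zero hne
  have h : IsPazObstruction n L X := ⟨hV, h1, hL, hX0, hX⟩
  exact h.four_lt.not_ge hn

end Obstruction

section Reduction

theorem pow_le_pow_of_mul_eq_zero {R A B C : Type*} [CommRing R] [Ring A] [Ring B] [Ring C]
    [Algebra R A] [Algebra R B] [Algebra R C] {φ : A →ₐ[R] B} {ψ : A →ₐ[R] C}
    (hφψ : ∀ a b, φ a = 0 → ψ b = 0 → a * b = 0) {L : Submodule R A} (h1 : 1 ≤ L) {k l : ℕ}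
    (hk : (L.map φ.toLinearMap) ^ (k + 1) ≤ (L.map φ.toLinearMap) ^ k)
    (hl : (L.map ψ.toLinearMap) ^ (l + 1) ≤ (L.map ψ.toLinearMap) ^ l) :
    L ^ (k + l + 2) ≤ L ^ (k + l + 1) := by
  have hmem {i j : ℕ} {a b : A} (ha : a ∈ L ^ i) (hb : b ∈ L ^ j) (hij : i + j ≤ k + l + 1) :
      a * b ∈ L ^ (k + l + 1) :=
    pow_le_pow_right' h1 hij (pow_add L i j ▸ Submodule.mul_mem_mul ha hb)
  rw [show k + l + 2 = (k + 1) + (l + 1) by ring, pow_add, Submodule.mul_le]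
  intro x hx z hz
  simp only [← Submodule.map_pow] at hk hl
  obtain ⟨y, hy, hyx⟩ := hk ⟨x, hx, rfl⟩
  obtain ⟨t, ht, htz⟩ := hl ⟨z, hz, rfl⟩
  have h0 : (x - y) * (z - t) = 0 := hφψ _ _
    (by rw [map_sub]; exact sub_eq_zero.mpr hyx.symm)
    (by rw [map_sub]; exact sub_eq_zero.mpr htz.symm)
  have hxz : x * z = x * t + y * z - y * t := by
    rw [← sub_eq_zero, ← h0]
    noncomm_ring
  rw [hxz]
  exact sub_mem (add_mem (hmem hx ht (by omega)) (hmem hy hz (by omega)))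
    (hmem hy ht (by omega))

variable {K : Type*} [Field K]

theorem pow_le_pow_of_smul_le {V : Type*} [AddCommGroup V] [Module K V]
    {L : Submodule K (End K V)} (h1 : 1 ≤ L) {W : Submodule K V} (hW : L • W ≤ W) {k l : ℕ}
    (hk : ∀ M : Submodule K (End K W), 1 ≤ M → M ^ (k + 1) ≤ M ^ k)
    (hl : ∀ M : Submodule K (End K (V ⧸ W)), 1 ≤ M → M ^ (l + 1) ≤ M ^ l) :
    L ^ (k + l + 2) ≤ L ^ (k + l + 1) := by
  let ι := (invariantSubalgebra W).val
  let L' := L.comap ι.toLinearMap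
  have hL' : L'.map ι.toLinearMap = L := Submodule.map_comap_eq_of_le fun a ha ↦
    ⟨⟨a, fun w hw ↦ hW (Submodule.smul_mem_smul ha hw)⟩, rfl⟩
  have h1' : 1 ≤ L' := Submodule.one_le.mpr (Submodule.one_le.mp h1 : (1 : End K V) ∈ L)
  have h1map {B : Type _} [Ring B] [Algebra K B] (φ : invariantSubalgebra W →ₐ[K] B) :
      1 ≤ L'.map φ.toLinearMap :=
    Submodule.one_le.mpr ⟨1, Submodule.one_le.mp h1', map_one φ⟩
  have := pow_le_pow_of_mul_eq_zero
    (fun _ _ ↦ mul_eq_zero_of_restrictHom_of_quotientHom) h1'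
    (hk _ (h1map (restrictHom W))) (hl _ (h1map (quotientHom W)))
  rw [← hL', ← Submodule.map_pow, ← Submodule.map_pow]
  exact Submodule.map_mono this

theorem pow_le_pow_of_finrank_le_of_isAlgClosed [IsAlgClosed K] {n : ℕ} (hn : n ≤ 4) {V : Type*}
    [AddCommGroup V] [Module K V] [FiniteDimensional K V] (hV : finrank K V ≤ n + 1)
    {L : Submodule K (End K V)} (h1 : 1 ≤ L) : L ^ (2 * n + 1) ≤ L ^ (2 * n) := by
  induction n using Nat.strong_induction_on generalizing V with
  | _ n ih =>
  by_cases hL : ActsIrreducibly L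
  · exact (hL.pow_eq_top h1 hV hn).symm ▸ le_top
  · obtain ⟨W, hW, hbot, htop⟩ : ∃ W : Submodule K V, L • W ≤ W ∧ W ≠ ⊥ ∧ W ≠ ⊤ := by
      simpa [ActsIrreducibly] using hL
    have hsum := W.finrank_quotient_add_finrank
    have hlt := Submodule.finrank_lt htop
    have hpos := Submodule.one_le_finrank_iff.mpr hbot
    obtain ⟨p, hp⟩ : ∃ p, finrank K W = p + 1 := ⟨_, (Nat.sub_add_cancel hpos).symm⟩
    obtain ⟨q, hq⟩ : ∃ q, finrank K (V ⧸ W) = q + 1 := ⟨finrank K (V ⧸ W) - 1, by omega⟩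
    have hstable : L ^ (2 * p + 2 * q + 2) ≤ L ^ (2 * p + 2 * q + 1) :=
      pow_le_pow_of_smul_le h1 hW (fun _ ↦ ih p (by omega) (by omega) hp.le)
        (fun _ ↦ ih q (by omega) (by omega) hq.le)
    calc L ^ (2 * n + 1) ≤ L ^ (2 * p + 2 * q + 1) :=
          pow_le_pow_of_pow_succ_le hstable (by omega)
      _ ≤ L ^ (2 * n) := pow_le_pow_right' h1 (by omega)

end Reduction

section BaseChange

open scoped Pointwise

variable {F K : Type*} [Field F] [Field K] [Algebra F K]

theorem mem_span_of_apply_mem_span_image {M N : Type*} [AddCommGroup M] [AddCommMonoid N]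
    [Module F M] [Module F N] [Module K N] [IsScalarTower F K N] {φ : M →ₗ[F] N}
    (hφ : IsBaseChange K φ) {T : Set M} {x : M} (hx : φ x ∈ Submodule.span K (φ '' T)) :
    x ∈ Submodule.span F T := by
  by_contra hxT
  obtain ⟨f, hfx, hfT⟩ := Submodule.exists_le_ker_of_notMem hxT
  let g : N →ₗ[K] K := hφ.lift (Algebra.linearMap F K ∘ₗ f)
  have hg (y : M) : g (φ y) = algebraMap F K (f y) := hφ.lift_eq _ y
  have hle : Submodule.span K (φ '' T) ≤ LinearMap.ker g := by
    rw [Submodule.span_le]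
    rintro _ ⟨y, hy, rfl⟩
    rw [SetLike.mem_coe, LinearMap.mem_ker, hg, hfT (Submodule.subset_span hy), map_zero]
  have : algebraMap F K (f x) = 0 := hg x ▸ hle hx
  exact hfx ((map_eq_zero _).mp this)

theorem pow_le_pow_of_isBaseChange {A B : Type*} [Ring A] [Semiring B] [Algebra F A] [Algebra F B]
    [Algebra K B] [IsScalarTower F K B] {φ : A →ₐ[F] B} (hφ : IsBaseChange K φ.toLinearMap)
    {L : Submodule F A} {k l : ℕ}
    (h : Submodule.span K (φ '' L) ^ k ≤ Submodule.span K (φ '' L) ^ l) : L ^ k ≤ L ^ l := by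
  rw [Submodule.span_pow, Submodule.span_pow, ← Set.image_pow, ← Set.image_pow] at h
  rw [Submodule.pow_eq_span_pow_set, Submodule.pow_eq_span_pow_set, Submodule.span_le]
  exact fun x hx ↦ mem_span_of_apply_mem_span_image hφ (h (Submodule.subset_span ⟨x, hx, rfl⟩))

theorem pow_le_pow_of_baseChange (K : Type*) [Field K] [Algebra F K] {V : Type*} [AddCommGroup V]
    [Module F V] [FiniteDimensional F V] {L : Submodule F (End F V)} (h1 : 1 ≤ L) {k l : ℕ}
    (h : ∀ M : Submodule K (End K (TensorProduct F K V)), 1 ≤ M → M ^ k ≤ M ^ l) :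
    L ^ k ≤ L ^ l := by
  have := Module.finitePresentation_of_finite F V
  let φ := Module.End.baseChangeHom F K V
  have hφ : IsBaseChange K φ.toLinearMap := Module.FinitePresentation.isBaseChange_map F V V K
  refine pow_le_pow_of_isBaseChange hφ (h _ (Submodule.one_le.mpr (Submodule.subset_span ?_)))
  exact ⟨1, Submodule.one_le.mp h1, map_one φ⟩

theorem pow_le_pow_of_finrank_le {n : ℕ} (hn : n ≤ 4) {V : Type*} [AddCommGroup V] [Module F V]
    [FiniteDimensional F V] (hV : finrank F V ≤ n + 1) {L : Submodule F (End F V)} (h1 : 1 ≤ L) :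
    L ^ (2 * n + 1) ≤ L ^ (2 * n) :=
  pow_le_pow_of_baseChange (AlgebraicClosure F) h1 fun _ ↦
    pow_le_pow_of_finrank_le_of_isAlgClosed hn (by rwa [finrank_baseChange])

end BaseChange

section Length

open scoped Pointwise

variable {F A : Type*} [Field F] [Ring A] [Algebra F A]

theorem exists_mem_wordsOfLength_of_mem_insert_one_pow {S : Set A} {k : ℕ} {a : A}
    (ha : a ∈ (insert 1 S) ^ k) : ∃ i ≤ k, a ∈ wordsOfLength S i := by
  induction k generalizing a with
  | zero => exact ⟨0, le_rfl, [], rfl, List.forall_mem_nil _, ha.symm⟩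
  | succ k ih =>
    rw [pow_succ'] at ha
    obtain ⟨x, hx, y, hy, rfl⟩ := ha
    obtain ⟨i, hi, w, hw, hwS, rfl⟩ := ih hy
    rcases hx with rfl | hx
    · exact ⟨i, by omega, w, hw, hwS, (one_mul _).symm⟩
    · exact ⟨i + 1, by omega, x :: w, by simp [hw], by simpa using ⟨hx, hwS⟩, List.prod_cons⟩

theorem wordsOfLength_subset_insert_one_pow (S : Set A) (k : ℕ) :
    wordsOfLength S k ⊆ (insert 1 S) ^ k := by
  rintro _ ⟨w, rfl, hw, rfl⟩
  induction w with
  | nil => exact Set.one_mem_one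
  | cons x w ih =>
    rw [List.prod_cons, List.length_cons, pow_succ']
    exact Set.mul_mem_mul (Set.mem_insert_of_mem 1 (hw x List.mem_cons_self))
      (ih fun y hy ↦ hw y (List.mem_cons_of_mem x hy))

theorem spanWordsLE_eq_span_insert_one_pow (S : Set A) (k : ℕ) :
    spanWordsLE F S k = Submodule.span F (insert 1 S) ^ k := by
  rw [Submodule.span_pow]
  refine le_antisymm (Submodule.span_mono ?_)
    (Submodule.span_mono fun _ ↦ exists_mem_wordsOfLength_of_mem_insert_one_pow)
  rintro a ⟨i, hi, ha⟩
  exact Set.pow_subset_pow_right (Set.mem_insert 1 S) hi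
    (wordsOfLength_subset_insert_one_pow S i ha)

theorem one_le_span_insert_one (S : Set A) : 1 ≤ Submodule.span F (insert 1 S) :=
  Submodule.one_le.mpr (Submodule.subset_span (Set.mem_insert 1 S))

theorem spanWordsLE_eq_adjoin {S : Set A} {k : ℕ}
    (h : Submodule.span F (insert 1 S) ^ (k + 1) ≤ Submodule.span F (insert 1 S) ^ k) :
    spanWordsLE F S k = Subalgebra.toSubmodule (Algebra.adjoin F S) := by
  refine le_antisymm (Submodule.span_le.mpr ?_) ?_
  · rintro _ ⟨i, -, w, -, hwS, rfl⟩
    exact Subalgebra.list_prod_mem _ fun x hx ↦ Algebra.subset_adjoin (hwS x hx)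
  · rw [spanWordsLE_eq_span_insert_one_pow, Algebra.adjoin_eq_span, Submodule.span_le]
    intro a ha
    induction ha using Submonoid.closure_induction_left with
    | one => exact Submodule.one_le.mp (one_le_pow_of_one_le' (one_le_span_insert_one S) k)
    | mul_left x hx y _ ih =>
      refine h ?_
      rw [pow_succ']
      exact Submodule.mul_mem_mul (Submodule.subset_span (Set.mem_insert_of_mem 1 hx)) ih

theorem algLength_le {S : Set A} {k : ℕ}
    (h : Submodule.span F (insert 1 S) ^ (k + 1) ≤ Submodule.span F (insert 1 S) ^ k) :
    algLength F S ≤ k :=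
  sInf_le ⟨k, spanWordsLE_eq_adjoin h, rfl⟩

theorem theorem3_general {V : Type*} [AddCommGroup V] [Module F V] [FiniteDimensional F V]
    {n : ℕ} (hn : n ≤ 4) (hV : finrank F V ≤ n + 1) {ρ : A →ₐ[F] End F V}
    (hρ : Function.Injective ρ) (S : Set A) : algLength F S ≤ (2 * n : ℕ) := by
  let L := Submodule.span F (insert 1 S)
  have h1 : 1 ≤ L.map ρ.toLinearMap :=
    Submodule.one_le.mpr ⟨1, Submodule.one_le.mp (one_le_span_insert_one S), map_one ρ⟩
  have hpow := pow_le_pow_of_finrank_le hn hV h1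
  rw [← Submodule.map_pow, ← Submodule.map_pow] at hpow
  exact algLength_le ((Submodule.map_le_map_iff_of_injective hρ _ _).mp hpow)

end Length

theorem theorem3 {F : Type*} [Field F] (S : Set (Matrix (Fin 5) (Fin 5) F)) :
    algLength F S ≤ 8 :=
  theorem3_general le_rfl (finrank_fin_fun F).le
    (ρ := (Matrix.toLinAlgEquiv' : Matrix (Fin 5) (Fin 5) F ≃ₐ[F] _).toAlgHom)
    Matrix.toLinAlgEquiv'.injective S
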